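/- A metric tree $T=(V,E,X)$ consists of a (finite or infinite) combinatorial tree $(V,E)$, i.e. a connected acyclic graph, a length $L_e>0$ for every edge $e\in E$, and the metric space $X$ obtained as follows: each edge $e=\{v,w\}$ is realized as an isometric copy $e_X$ of the segment $[0,L_e]$, the endpoints of the realized edges are identified with the vertices in $V$ as prescribed by $E$, and $d(x,y)$ is the length of the unique non-self-intersecting path between $x$ and $y$, i.e. the sum of the lengths of the edges and partial edges along this path. (If $V$ is a single vertex, $X$ is a single point.) The tree is bounded if $X$ is a bounded metric space; $X$ is not assumed to be complete or compact. A map $f:X\to Y$ between metric spaces is compact if for every bounded set $B\subseteq X$ the image $f(B)$ is contained in a compact subset of $Y$. **Theorem.** Let $T=(V,E,X)$ be a bounded metric tree, possibly with infinitely many vertices. Then every continuous compact map $f:X\to X$ has a fixed point, i.e. there is $x\in X$ with $f(x)=x$. -/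

import Mathlib

/-- A metric tree `(V, E, X)`: a combinatorial tree `(V, E)` together with a metric space `X`
obtained by realizing every edge `e` as a copy of a segment `[0, len e]`, gluing the ends of
these segments at the vertices, and measuring distances along the tree.

Only the values of `len` on the edges of the graph matter. The realization of edges is injective
apart from the gluing at vertices: this follows from `dist_eq`, which makes the distance
positive between distinct vertices, and between an interior point of a realized edge and
any point of another realized edge. -/
structure MetricTree (V X : Type*) [MetricSpace X] where
  /-- The combinatorial graph `(V, E)`. -/
  graph : SimpleGraph V
  isTree : graph.IsTree
  /-- The lengths of the edges. -/
  len : Sym2 V → ℝ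
  len_pos : ∀ e ∈ graph.edgeSet, 0 < len e
  /-- The point of `X` that realizes a vertex. -/
  vertex : V → X
  /-- The parametrization of the realized edge `e` by `[0, len e]`. -/
  edgeMap : (e : graph.edgeSet) → Set.Icc (0 : ℝ) (len e) → X
  isometry_edgeMap : ∀ e, Isometry (edgeMap e)
  /-- The two ends of the realized edge `e` are the two vertices of `e`. -/
  edgeMap_ends : ∀ e : graph.edgeSet, ∃ v w : V, (e : Sym2 V) = s(v, w) ∧
    edgeMap e ⟨0, Set.left_mem_Icc.2 (len_pos e e.2).le⟩ = vertex v ∧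
    edgeMap e ⟨len e, Set.right_mem_Icc.2 (len_pos e e.2).le⟩ = vertex w
  /-- `X` consists of the vertices and of the points of the realized edges. (The vertices have to
  be mentioned only for the tree with a single vertex and no edge.) -/
  cover : ∀ x : X, x ∈ Set.range vertex ∨ ∃ e, x ∈ Set.range (edgeMap e)
  /-- The distance between points `x`, `y` of different realized edges `e`, `e'` is the length of
  the path from `x` to `y`: that path runs inside `e` from `x` to an endpoint `v` of `e`,
  then along the path `p` of the combinatorial tree from `v` to an endpoint `w` of `e'`, where `p`
  uses neither `e` nor `e'`, and then inside `e'` from `w` to `y`. -/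
  dist_eq : ∀ (e e' : graph.edgeSet), e ≠ e' →
    ∀ x ∈ Set.range (edgeMap e), ∀ y ∈ Set.range (edgeMap e'),
    ∀ (v w : V), v ∈ (e : Sym2 V) → w ∈ (e' : Sym2 V) →
    ∀ p : graph.Walk v w, p.IsPath → (e : Sym2 V) ∉ p.edges → (e' : Sym2 V) ∉ p.edges →
      dist x y = dist x (vertex v) + (p.edges.map len).sum + dist (vertex w) y

/-- A metric tree is bounded if its underlying metric space is. -/
def MetricTree.IsBounded {V X : Type*} [MetricSpace X] (_T : MetricTree V X) : Prop :=
  Bornology.IsBounded (Set.univ : Set X)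

/-- A map between metric spaces is compact if it maps every bounded set into a compact set. -/
def IsCompactMap {X Y : Type*} [MetricSpace X] [MetricSpace Y] (f : X → Y) : Prop :=
  ∀ B : Set X, Bornology.IsBounded B → ∃ K : Set Y, IsCompact K ∧ f '' B ⊆ K

/-! Root the tree at a vertex `p` and order it by ancestry: `x` precedes `y` if it lies on the
segment `[p, y]`. The points preceding their image include `p`, and Zorn's lemma gives a maximal one
`x`. It is fixed: otherwise a small step from `x` towards `f x` reaches a larger such point, because
nearby images share a long initial segment (`fixed_of_maximal`).

Since `X` may be incomplete, chains are bounded through the compact set `K` containing all images: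
along a chain without a farthest point, the images accumulate at some `y`, and the chain converges
to a point of `[p, y]` (`exists_upper_bound`).

The tree enters only through `IsTreelikeAt`, which follows by induction along edges from the root,
using gates of edges (`exists_gate`). -/

/-- In the tree rooted at `p`, the point `x` is an ancestor of `y`: it lies on the segment
from `p` to `y`. -/
def IsAncestor {X : Type*} [MetricSpace X] (p x y : X) : Prop :=
  dist p x + dist x y = dist p y

namespace IsAncestor

variable {X : Type*} [MetricSpace X] {p x y z : X}

theorem refl (p x : X) : IsAncestor p x x := by simp [IsAncestor]

theorem root (p x : X) : IsAncestor p p x := by simp [IsAncestor]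

theorem dist_le (h : IsAncestor p x y) : dist p x ≤ dist p y := by
  have := dist_nonneg (x := x) (y := y)
  unfold IsAncestor at h
  linarith

theorem trans (h : IsAncestor p x y) (h' : IsAncestor p y z) : IsAncestor p x z := by
  unfold IsAncestor at *
  have := dist_triangle x y z
  have := dist_triangle p x z
  linarith

theorem eq_of_dist_le (h : IsAncestor p x y) (hd : dist p y ≤ dist p x) : x = y := by
  unfold IsAncestor at h
  have := dist_nonneg (x := x) (y := y)
  exact dist_le_zero.1 (by linarith)

end IsAncestor

/-! ### Fixed points in treelike spaces -/

open Filter Topology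

/-- A metric space is treelike at `p` if it contains the segments from `p` to all points, and these
segments branch as in a tree: the segments from `p` to `z` and to `w` coincide up to
the distance `(z | w)_p` (the Gromov product) from `p`. -/
structure IsTreelikeAt {X : Type*} [MetricSpace X] (p : X) : Prop where
  exists_ancestor : ∀ y : X, ∀ s, 0 ≤ s → s ≤ dist p y → ∃ x, dist p x = s ∧ IsAncestor p x y
  branch : ∀ x z w : X, IsAncestor p x z → 2 * dist p x ≤ dist p z + dist p w - dist z w →
    IsAncestor p x w

namespace IsTreelikeAt

variable {X : Type*} [MetricSpace X] {p : X}

theorem isAncestor_of_dist_le (hp : IsTreelikeAt p) {x y z : X} (hx : IsAncestor p x z)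
    (hy : IsAncestor p y z) (h : dist p x ≤ dist p y) : IsAncestor p x y := by
  refine hp.branch x z y hx ?_
  unfold IsAncestor at hy
  rw [dist_comm z y]
  linarith

/-- A maximal point among those `x` that are ancestors of `f x` is fixed by `f`. -/
theorem fixed_of_maximal (hp : IsTreelikeAt p) {f : X → X} (hf : Continuous f) {x : X}
    (hx : IsAncestor p x (f x))
    (hmax : ∀ y, IsAncestor p y (f y) → IsAncestor p x y → y = x) : f x = x := by
  by_contra hne
  have hD : 0 < dist x (f x) := dist_pos.2 (Ne.symm hne)
  set D := dist x (f x) with hDdef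
  obtain ⟨δ, hδ, hfδ⟩ := Metric.continuous_iff.1 hf x (D / 2) (by positivity)
  have hx' : dist p x + D = dist p (f x) := hx
  have ht0 : 0 < min (δ / 2) (D / 2) := by positivity
  have htδ : min (δ / 2) (D / 2) < δ := (min_le_left _ _).trans_lt (by linarith)
  have htD : min (δ / 2) (D / 2) ≤ D / 2 := min_le_right _ _
  set t := min (δ / 2) (D / 2)
  have hpx := dist_nonneg (x := p) (y := x)
  obtain ⟨y, hys, hy⟩ := hp.exists_ancestor (f x) (dist p x + t) (by linarith) (by linarith)
  have hxy : IsAncestor p x y := hp.isAncestor_of_dist_le hx hy (by linarith)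
  have hxyd : dist x y = t := by
    unfold IsAncestor at hxy
    linarith
  have hfy : dist (f y) (f x) < D / 2 := hfδ y (by rw [dist_comm, hxyd]; exact htδ)
  -- The Gromov product of `f x` and `f y` at `p` is at least `dist p (f x) - dist (f x) (f y)`,
  -- which exceeds `dist p x + D / 2` and hence is at least `dist p y`.
  have hyx : y = x := hmax y (hp.branch y (f x) (f y) hy ?_) hxy
  · rw [hyx, dist_self] at hxyd
    linarith
  · have := dist_triangle p (f y) (f x)
    rw [dist_comm (f x) (f y)]
    linarith

/-- A nonempty chain of points `x` that are ancestors of `f x` has an upper bound of this kind. -/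
theorem exists_upper_bound (hp : IsTreelikeAt p) {f : X → X} (hf : Continuous f) {K : Set X}
    (hK : IsCompact K) (hfK : ∀ x, f x ∈ K) {c : Set X} (hc : ∀ x ∈ c, IsAncestor p x (f x))
    (hchain : ∀ x ∈ c, ∀ y ∈ c, IsAncestor p x y ∨ IsAncestor p y x) (hne : c.Nonempty) :
    ∃ u, IsAncestor p u (f u) ∧ ∀ x ∈ c, IsAncestor p x u := by
  by_cases hattained : ∃ u ∈ c, ∀ x ∈ c, dist p x ≤ dist p u
  · obtain ⟨u, hu, hmax⟩ := hattained
    refine ⟨u, hc u hu, fun x hx => ?_⟩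
    rcases hchain x hx u hu with h | h
    · exact h
    · rw [h.eq_of_dist_le (hmax x hx)]
      exact IsAncestor.refl _ _
  push Not at hattained
  have hbdd : BddAbove (dist p '' c) := by
    obtain ⟨R, hR⟩ := hK.isBounded.subset_closedBall p
    refine ⟨R, ?_⟩
    rintro _ ⟨x, hx, rfl⟩
    have := hR (hfK x)
    rw [Metric.mem_closedBall, dist_comm] at this
    exact (hc x hx).dist_le.trans this
  have hne' : (dist p '' c).Nonempty := hne.image _
  set r := sSup (dist p '' c) with hr
  have hlt : ∀ x ∈ c, dist p x < r := fun x hx => by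
    obtain ⟨u, hu, hxu⟩ := hattained x hx
    exact hxu.trans_le (le_csSup hbdd ⟨u, hu, rfl⟩)
  obtain ⟨h, -, hlim, hmem⟩ := exists_seq_tendsto_sSup hne' hbdd
  choose s hsc hsh using hmem
  -- Only the images are known to accumulate; the limit of `s` itself is found later, on the segment
  -- to `y`.
  obtain ⟨y, -, φ, hφ, hy⟩ := hK.tendsto_subseq (fun n => hfK (s n))
  have hlim' : Tendsto (fun n => dist p (s (φ n))) atTop (𝓝 r) := by
    simp only [hsh]
    exact hlim.comp hφ.tendsto_atTop
  -- Ancestry is an equation between distances, so it passes to limits; eventually `s (φ n)` is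
  -- farther from `p` than `x`, hence above it in the chain.
  have hcy : ∀ x ∈ c, IsAncestor p x y := fun x hx => by
    have h1 : Tendsto (fun n => dist p x + dist x (f (s (φ n)))) atTop
        (𝓝 (dist p x + dist x y)) := tendsto_const_nhds.add (tendsto_const_nhds.dist hy)
    have h2 : Tendsto (fun n => dist p (f (s (φ n)))) atTop (𝓝 (dist p y)) :=
      tendsto_const_nhds.dist hy
    refine tendsto_nhds_unique_of_eventuallyEq h1 h2 ?_
    filter_upwards [hlim'.eventually (lt_mem_nhds (hlt x hx))] with n hn
    rcases hchain x hx _ (hsc (φ n)) with h | h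
    · exact h.trans (hc _ (hsc _))
    · exact absurd h.dist_le (not_le.2 hn)
  have hry : r ≤ dist p y := csSup_le hne' (by rintro _ ⟨x, hx, rfl⟩; exact (hcy x hx).dist_le)
  have hr0 : 0 ≤ r := by
    obtain ⟨x, hx⟩ := hne
    exact dist_nonneg.trans (hlt x hx).le
  obtain ⟨u, hur, huy⟩ := hp.exists_ancestor y r hr0 hry
  have hcu : ∀ x ∈ c, IsAncestor p x u := fun x hx =>
    hp.isAncestor_of_dist_le (hcy x hx) huy (by rw [hur]; exact (hlt x hx).le)
  refine ⟨u, ?_, hcu⟩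
  have hsu : Tendsto (fun n => s (φ n)) atTop (𝓝 u) := by
    rw [tendsto_iff_dist_tendsto_zero]
    have h1 : Tendsto (fun n => r - dist p (s (φ n))) atTop (𝓝 (r - r)) :=
      tendsto_const_nhds.sub hlim'
    rw [sub_self] at h1
    refine h1.congr fun n => ?_
    have := hcu _ (hsc (φ n))
    unfold IsAncestor at this
    linarith
  have hfu : Tendsto (fun n => f (s (φ n))) atTop (𝓝 (f u)) := (hf.tendsto u).comp hsu
  refine tendsto_nhds_unique (f := fun n => dist p (f (s (φ n)))) (l := atTop) ?_
    (tendsto_const_nhds.dist hfu)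
  exact (((tendsto_const_nhds (x := p)).dist hsu).add (hsu.dist hfu)).congr
    fun n => hc _ (hsc (φ n))

/-- A continuous self-map of a treelike space with relatively compact image has a fixed point. -/
theorem exists_fixed_point (hp : IsTreelikeAt p) {f : X → X} (hf : Continuous f) {K : Set X}
    (hK : IsCompact K) (hfK : ∀ x, f x ∈ K) : ∃ x, f x = x := by
  have : Nonempty {x // IsAncestor p x (f x)} := ⟨⟨p, IsAncestor.root _ _⟩⟩
  have hub : ∀ c : Set {x // IsAncestor p x (f x)}, IsChain (fun x y => IsAncestor p x.1 y.1) c →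
      c.Nonempty → ∃ u : {x // IsAncestor p x (f x)}, ∀ x ∈ c, IsAncestor p x.1 u.1 := by
    intro c hc hne
    obtain ⟨u, hu, hcu⟩ := hp.exists_upper_bound hf hK hfK (c := Subtype.val '' c)
      (by rintro _ ⟨x, -, rfl⟩; exact x.2)
      (by
        rintro _ ⟨x, hx, rfl⟩ _ ⟨y, hy, rfl⟩
        by_cases hxy : x = y
        · subst hxy
          exact Or.inl (IsAncestor.refl _ _)
        · exact hc hx hy hxy)
      (hne.image _)
    exact ⟨⟨u, hu⟩, fun x hx => hcu x ⟨x, hx, rfl⟩⟩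
  obtain ⟨m, hm⟩ := exists_maximal_of_nonempty_chains_bounded hub (fun h h' => h.trans h')
  exact ⟨m, hp.fixed_of_maximal hf m.2 fun y hy hmy =>
    (hm ⟨y, hy⟩ hmy).eq_of_dist_le hmy.dist_le⟩

end IsTreelikeAt

/-! ### Edges of paths in graphs -/

theorem SimpleGraph.Walk.IsPath.exists_eq_cons {V : Type*} {G : SimpleGraph V} {u w : V}
    {p : G.Walk u w} (hp : p.IsPath) {e : Sym2 V} (hu : u ∈ e) (he : e ∈ p.edges) :
    ∃ (c : V) (h : G.Adj u c) (q : G.Walk c w),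
      p = .cons h q ∧ e = s(u, c) ∧ q.IsPath ∧ e ∉ q.edges := by
  cases p with
  | nil => simp at he
  | @cons _ c _ h q =>
    rw [SimpleGraph.Walk.cons_isPath_iff] at hp
    -- A path visits its start only once, so an edge at `u` can only be the first edge.
    have hq : e ∉ q.edges := fun hq => hp.2 (q.mem_support_of_mem_edges hq hu)
    refine ⟨c, h, q, rfl, ?_, hp.1, hq⟩
    simpa [hq] using he

theorem List.IsChain.concat_ne {α : Type*} {l : List α} (hl : l.IsChain (· ≠ ·)) {a : α}
    (ha : a ∉ l) : (l ++ [a]).IsChain (· ≠ ·) := by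
  refine hl.append (List.isChain_singleton a) fun x hx y hy => ?_
  simp only [List.head?_cons, Option.mem_def, Option.some.injEq] at hy
  subst hy
  rintro rfl
  exact ha (List.mem_of_mem_getLast? hx)

/-! ### Realized edges and directions from the root -/

namespace MetricTree

variable {V X : Type*} [MetricSpace X] (T : MetricTree V X)

/-- The realization of an edge as a subset of `X`. -/
def segment (e : T.graph.edgeSet) : Set X := Set.range (T.edgeMap e)

variable {T}

/-- Reversing `edgeMap` by `t ↦ len e - t` lets either end serve as the origin. -/
theorem exists_param {e : T.graph.edgeSet} {v : V} (hv : v ∈ (e : Sym2 V)) :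
    ∃ g : Set.Icc (0 : ℝ) (T.len e) → X, Isometry g ∧ Set.range g = T.segment e ∧
      g ⟨0, Set.left_mem_Icc.2 (T.len_pos e e.2).le⟩ = T.vertex v ∧
      ∀ w, (e : Sym2 V) = s(v, w) →
        g ⟨T.len e, Set.right_mem_Icc.2 (T.len_pos e e.2).le⟩ = T.vertex w := by
  obtain ⟨a, b, hab, ha, hb⟩ := T.edgeMap_ends e
  rw [hab, Sym2.mem_iff] at hv
  rcases hv with rfl | rfl
  · refine ⟨T.edgeMap e, T.isometry_edgeMap e, rfl, ha, fun w hw => ?_⟩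
    rw [hab, Sym2.congr_right] at hw
    rw [hb, hw]
  · let σ : Set.Icc (0 : ℝ) (T.len e) → Set.Icc (0 : ℝ) (T.len e) := fun t =>
      ⟨T.len e - t, by linarith [t.2.2], by linarith [t.2.1]⟩
    have hσ : Function.Surjective σ := fun t => ⟨σ t, Subtype.ext (by simp [σ])⟩
    refine ⟨T.edgeMap e ∘ σ, (T.isometry_edgeMap e).comp (Isometry.of_dist_eq fun s t => ?_),
      hσ.range_comp _, ?_, fun w hw => ?_⟩
    · simp only [σ, Subtype.dist_eq, dist_sub_left]
    · rw [← hb]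
      simp [σ]
    · rw [hab, Sym2.eq_swap, Sym2.congr_right] at hw
      rw [← hw, ← ha]
      simp [σ]

theorem vertex_mem_segment {e : T.graph.edgeSet} {v : V} (hv : v ∈ (e : Sym2 V)) :
    T.vertex v ∈ T.segment e := by
  obtain ⟨g, -, hg, h0, -⟩ := exists_param hv
  rw [← hg, ← h0]
  exact Set.mem_range_self _

theorem dist_vertex_vertex {e : T.graph.edgeSet} {v w : V} (he : (e : Sym2 V) = s(v, w)) :
    dist (T.vertex v) (T.vertex w) = T.len e := by
  obtain ⟨g, hi, -, h0, h1⟩ := exists_param (e := e) (v := v) (by simp [he])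
  rw [← h0, ← h1 w he, hi.dist_eq, Subtype.dist_eq, dist_comm, Real.dist_0_eq_abs]
  exact abs_of_pos (T.len_pos e e.2)

theorem exists_dist_vertex_eq {e : T.graph.edgeSet} {v : V} (hv : v ∈ (e : Sym2 V)) {y : X}
    (hy : y ∈ T.segment e) {s : ℝ} (hs : 0 ≤ s) (hs' : s ≤ dist (T.vertex v) y) :
    ∃ x ∈ T.segment e, dist (T.vertex v) x = s := by
  obtain ⟨g, hi, hg, h0, -⟩ := exists_param hv
  rw [← hg] at hy ⊢
  obtain ⟨t, rfl⟩ := hy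
  have key : ∀ s, dist (T.vertex v) (g s) = s := fun s => by
    rw [← h0, hi.dist_eq, Subtype.dist_eq, dist_comm, Real.dist_0_eq_abs]
    exact abs_of_nonneg s.2.1
  rw [key] at hs'
  exact ⟨g ⟨s, hs, hs'.trans t.2.2⟩, Set.mem_range_self _, key _⟩

theorem dist_vertex_add_dist {e : T.graph.edgeSet} {v : V} (hv : v ∈ (e : Sym2 V)) {x y : X}
    (hx : x ∈ T.segment e) (hy : y ∈ T.segment e)
    (h : dist (T.vertex v) x ≤ dist (T.vertex v) y) :
    dist (T.vertex v) x + dist x y = dist (T.vertex v) y := by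
  obtain ⟨g, hi, hg, h0, -⟩ := exists_param hv
  rw [← hg] at hx hy
  obtain ⟨s, rfl⟩ := hx
  obtain ⟨t, rfl⟩ := hy
  have key : ∀ s, dist (T.vertex v) (g s) = s := fun s => by
    rw [← h0, hi.dist_eq, Subtype.dist_eq, dist_comm, Real.dist_0_eq_abs]
    exact abs_of_nonneg s.2.1
  rw [key, key] at h ⊢
  rw [hi.dist_eq, Subtype.dist_eq, Real.dist_eq, abs_sub_comm, abs_of_nonneg (by linarith)]
  ring

/-- The distance from a vertex to a point of an edge is measured along a path to this edge. -/
theorem dist_eq_of_path {r b : V} {p : T.graph.Walk r b} (hp : p.IsPath) {e : T.graph.edgeSet}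
    (hb : b ∈ (e : Sym2 V)) (he : (e : Sym2 V) ∉ p.edges) {y : X} (hy : y ∈ T.segment e) :
    dist (T.vertex r) y = (p.edges.map T.len).sum + dist (T.vertex b) y := by
  cases p with
  | nil => simp
  | @cons _ c _ h q =>
    -- `dist_eq` compares points of two edges, so the vertex `r` is viewed as a point of the first
    -- edge of the path.
    let e₀ : T.graph.edgeSet := ⟨s(r, c), h⟩
    have hne : e₀ ≠ e := by
      rintro rfl
      simp [e₀] at he
    have hnd := hp.isTrail.edges_nodup
    rw [SimpleGraph.Walk.edges_cons, List.nodup_cons] at hnd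
    rw [SimpleGraph.Walk.edges_cons, List.mem_cons, not_or] at he
    rw [T.dist_eq e₀ e hne _ (vertex_mem_segment (v := r) (by simp [e₀])) y hy c b
      (by simp [e₀]) hb q hp.of_cons hnd.1 he.2, dist_vertex_vertex (e := e₀) rfl]
    simp [e₀]

variable (T) in
/-- The edge `e` has the ends `u` and `v`, and `u` is the end closer to `r`. -/
def IsDirected (r : V) (e : T.graph.edgeSet) (u v : V) : Prop :=
  (e : Sym2 V) = s(u, v) ∧ ∃ q : T.graph.Walk r u, q.IsPath ∧ (e : Sym2 V) ∉ q.edges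

/-- The path from an end of `e` to `r` either starts with `e` or avoids it; this decides which end
is closer. -/
theorem exists_isDirected (r : V) (e : T.graph.edgeSet) : ∃ u v, T.IsDirected r e u v := by
  obtain ⟨e, he⟩ := e
  induction e with | _ a b
  obtain ⟨p, hp, -⟩ := T.isTree.existsUnique_path a r
  by_cases hep : s(a, b) ∈ p.edges
  · obtain ⟨c, h, q, -, hc, hq, hqe⟩ := hp.exists_eq_cons (by simp) hep
    exact ⟨c, a, hc.trans Sym2.eq_swap, q.reverse, hq.reverse, by simpa using hqe⟩
  · exact ⟨a, b, rfl, p.reverse, hp.reverse, by simpa using hep⟩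

/-- The given edge excludes the one-vertex tree, so every vertex lies on an edge. -/
theorem exists_mem_segment (e : T.graph.edgeSet) (y : X) : ∃ e', y ∈ T.segment e' := by
  rcases T.cover y with ⟨w, rfl⟩ | h
  · obtain ⟨e, he⟩ := e
    induction e with | _ a b
    obtain ⟨p⟩ := T.isTree.connected.preconnected w a
    cases p with
    | nil => exact ⟨⟨s(w, b), he⟩, vertex_mem_segment (by simp)⟩
    | @cons _ c _ h q => exact ⟨⟨s(w, c), h⟩, vertex_mem_segment (by simp)⟩
  · exact h

/-- Points of the tree can be reached from the root by passing through edges. -/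
theorem induction_from_root {P : X → Prop} (r : V) (root : P (T.vertex r))
    (step : ∀ e u v, T.IsDirected r e u v → P (T.vertex u) → ∀ x ∈ T.segment e, P x) (x : X) :
    P x := by
  have vert : ∀ {w s : V} (p : T.graph.Walk w s), s = r → p.IsPath → P (T.vertex w) := by
    intro w s p
    induction p with
    | nil => rintro rfl -; exact root
    | @cons a c s h q ih =>
      rintro rfl hp
      have hnd := hp.isTrail.edges_nodup
      rw [SimpleGraph.Walk.edges_cons, List.nodup_cons] at hnd
      exact step ⟨s(a, c), h⟩ c a ⟨Sym2.eq_swap, q.reverse, hp.of_cons.reverse, by simpa using hnd.1⟩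
        (ih rfl hp.of_cons) _ (vertex_mem_segment (by simp))
  have vert' : ∀ w, P (T.vertex w) := fun w => by
    obtain ⟨p, hp, -⟩ := T.isTree.existsUnique_path w r
    exact vert p rfl hp
  rcases T.cover x with ⟨w, rfl⟩ | ⟨e, hx⟩
  · exact vert' w
  · obtain ⟨u, v, h⟩ := exists_isDirected r e
    exact step e u v h (vert' u) x hx

/-! ### Gates of a directed edge -/

namespace IsDirected

variable {r u v : V} {e : T.graph.edgeSet} (he : T.IsDirected r e u v)
include he

theorem left_mem : u ∈ (e : Sym2 V) := by simp [he.1]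

theorem right_mem : v ∈ (e : Sym2 V) := by simp [he.1]

theorem isAncestor_left {x : X} (hx : x ∈ T.segment e) :
    IsAncestor (T.vertex r) (T.vertex u) x := by
  obtain ⟨-, q, hq, heq⟩ := id he
  unfold IsAncestor
  rw [dist_eq_of_path hq he.left_mem heq hx,
    dist_eq_of_path hq he.left_mem heq (vertex_mem_segment he.left_mem), dist_self, add_zero]

theorem isAncestor_of_dist_le {x y : X} (hx : x ∈ T.segment e) (hy : y ∈ T.segment e)
    (h : dist (T.vertex u) x ≤ dist (T.vertex u) y) : IsAncestor (T.vertex r) x y := by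
  have h1 := he.isAncestor_left hx
  have h2 := he.isAncestor_left hy
  have h3 := dist_vertex_add_dist he.left_mem hx hy h
  unfold IsAncestor at *
  linarith

/-- Every point `y` has a gate in the segment of `e`, which is the lower end or an ancestor of `y`.
-/
theorem exists_gate (y : X) :
    (∀ z ∈ T.segment e, dist z y = dist z (T.vertex u) + dist (T.vertex u) y) ∨
    ∃ g ∈ T.segment e, IsAncestor (T.vertex r) g y ∧
      ∀ z ∈ T.segment e, dist z y = dist z g + dist g y := by
  obtain ⟨heuv, q, hq, heq⟩ := id he
  obtain ⟨e', hy⟩ := exists_mem_segment e y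
  by_cases hne : e = e'
  · subst hne
    exact Or.inr ⟨y, hy, IsAncestor.refl _ _, fun z _ => by simp⟩
  obtain ⟨b, b', hb', p, hp, hep'⟩ := exists_isDirected u e'
  have hb : b ∈ (e' : Sym2 V) := by simp [hb']
  -- If the path from `u` to the edge of `y` starts with `e`, the gate is `v`; otherwise it is `u`.
  by_cases hep : (e : Sym2 V) ∈ p.edges
  · right
    obtain ⟨c, h, p', rfl, hc, hp', hep⟩ := hp.exists_eq_cons he.left_mem hep
    obtain rfl : v = c := by rwa [heuv, Sym2.congr_right] at hc
    rw [SimpleGraph.Walk.edges_cons, List.mem_cons, not_or] at hep'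
    have hvy := dist_eq_of_path hp' hb hep'.2 hy
    refine ⟨T.vertex v, vertex_mem_segment he.right_mem, ?_, fun z hz => ?_⟩
    · have hbb' : T.graph.Adj b b' := by
        rw [← SimpleGraph.mem_edgeSet, ← hb']
        exact e'.2
      let W := q.append (.cons h p')
      -- In an acyclic graph a walk without immediate backtracking is a path, so two such edge lists
      -- may be glued along the shared edge `s(u, v)`. Appending `e'` also shows that `W` avoids it.
      have hW : (W.concat hbb').IsPath := by
        rw [T.isTree.isAcyclic.isPath_iff_isChain] at hq hp ⊢
        have h1 : (q.edges ++ [s(u, v)]).IsChain (· ≠ ·) := hq.concat_ne (heuv ▸ heq)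
        have h2 : ([s(u, v)] ++ (p'.edges ++ [s(b, b')])).IsChain (· ≠ ·) := by
          rw [SimpleGraph.Walk.edges_cons] at hp
          refine hp.concat_ne ?_
          rw [← hb', List.mem_cons, not_or]
          exact hep'
        simpa [W] using h1.append_overlap h2 (by simp)
      have hWe : (e' : Sym2 V) ∉ W.edges := by
        have := hW.isTrail.edges_nodup
        rw [SimpleGraph.Walk.edges_concat, List.concat_eq_append, List.nodup_append] at this
        intro hmem
        exact this.2.2 _ hmem _ (by simp) hb'
      have hWp : W.IsPath := by
        rw [SimpleGraph.Walk.concat_isPath_iff] at hW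
        exact hW.1
      have h1 := dist_eq_of_path hWp hb hWe hy
      have h2 := dist_eq_of_path hq he.left_mem heq (vertex_mem_segment he.right_mem)
      rw [dist_vertex_vertex heuv, heuv] at h2
      simp only [W, SimpleGraph.Walk.edges_append, SimpleGraph.Walk.edges_cons, List.map_append,
        List.map_cons, List.sum_append, List.sum_cons] at h1
      unfold IsAncestor
      linarith
    · rw [T.dist_eq e e' hne z hz y hy v b he.right_mem hb p' hp' hep hep'.2, hvy, add_assoc]
  · left
    intro z hz
    rw [T.dist_eq e e' hne z hz y hy u b he.left_mem hb p hp hep hep',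
      dist_eq_of_path hp hb hep' hy, add_assoc]

/-- If the gate of `y` is `u`, the segment from `x` to `y` passes through `u`. A gate `g` that is an
ancestor of `y` must equal `y`, or else the segment from the root to `x` through `y` would be longer
than the route through `g`. -/
theorem mem_or_isAncestor {x y : X} (hx : x ∈ T.segment e) (hyx : IsAncestor (T.vertex r) y x) :
    y ∈ T.segment e ∨ IsAncestor (T.vertex r) y (T.vertex u) := by
  have hux := he.isAncestor_left hx
  rcases he.exists_gate y with h | ⟨g, hg, hgy, h⟩
  · right
    have := h x hx
    unfold IsAncestor at *
    rw [dist_comm y (T.vertex u), dist_comm x (T.vertex u)] at *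
    rw [dist_comm x y] at this
    linarith
  · left
    have h1 := h x hx
    have h2 := dist_triangle (T.vertex r) g x
    have h3 := dist_nonneg (x := g) (y := y)
    unfold IsAncestor at *
    rw [dist_comm x y, dist_comm x g] at h1
    rwa [← dist_le_zero.1 (show dist g y ≤ 0 by linarith)]

end IsDirected

/-! ### Metric trees are treelike -/

theorem isAncestor_or_isAncestor (r : V) (z : X) : ∀ x y : X, IsAncestor (T.vertex r) x z →
    IsAncestor (T.vertex r) y z →
    IsAncestor (T.vertex r) x y ∨ IsAncestor (T.vertex r) y x := by
  induction z using induction_from_root (T := T) r with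
  | root =>
    intro x y hx hy
    have h := hx.eq_of_dist_le (by simp)
    subst h
    exact Or.inr hy
  | step e u v he ih z hz =>
    intro x y hx hy
    rcases he.mem_or_isAncestor hz hx with hxe | hxu
    · rcases he.mem_or_isAncestor hz hy with hye | hyu
      · exact (le_total _ _).imp (he.isAncestor_of_dist_le hxe hye)
          (he.isAncestor_of_dist_le hye hxe)
      · exact Or.inr (hyu.trans (he.isAncestor_left hxe))
    · rcases he.mem_or_isAncestor hz hy with hye | hyu
      · exact Or.inl (hxu.trans (he.isAncestor_left hye))
      · exact ih x y hxu hyu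

/-- The paths from the root to `x` and to `y` part at a point of the segment from `x` to `y`. -/
theorem exists_common_ancestor (r : V) (x : X) : ∀ y : X, ∃ m, IsAncestor (T.vertex r) m x ∧
    IsAncestor (T.vertex r) m y ∧ dist x y = dist x m + dist m y := by
  induction x using induction_from_root (T := T) r with
  | root =>
    exact fun y => ⟨T.vertex r, IsAncestor.refl _ _, IsAncestor.root _ _, by simp⟩
  | step e u v he ih x hx =>
    intro y
    have hux := he.isAncestor_left hx
    -- With gate `u`, the parting point for `u` also serves for `x`; otherwise it is the lower of
    -- `x` and the gate `g` on the edge.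
    rcases he.exists_gate y with h | ⟨g, hg, hgy, h⟩
    · obtain ⟨m, hmu, hmy, hm⟩ := ih y
      refine ⟨m, hmu.trans hux, hmy, ?_⟩
      have h1 := hmu.trans hux
      have h2 := h x hx
      unfold IsAncestor at *
      rw [dist_comm x (T.vertex u)] at h2
      rw [dist_comm (T.vertex u) m] at hm
      rw [dist_comm x m]
      linarith
    · rcases le_total (dist (T.vertex u) x) (dist (T.vertex u) g) with hle | hle
      · exact ⟨x, IsAncestor.refl _ _, (he.isAncestor_of_dist_le hx hg hle).trans hgy, by simp⟩
      · exact ⟨g, he.isAncestor_of_dist_le hg hx hle, hgy, h x hx⟩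

theorem exists_ancestor (r : V) (y : X) : ∀ s, 0 ≤ s → s ≤ dist (T.vertex r) y →
    ∃ x, dist (T.vertex r) x = s ∧ IsAncestor (T.vertex r) x y := by
  induction y using induction_from_root (T := T) r with
  | root =>
    intro s hs hs'
    exact ⟨T.vertex r, le_antisymm (by simpa using hs) hs', IsAncestor.refl _ _⟩
  | step e u v he ih y hy =>
    intro s hs hsy
    have huy := he.isAncestor_left hy
    rcases le_total s (dist (T.vertex r) (T.vertex u)) with hsu | hsu
    · obtain ⟨x, hx, hxu⟩ := ih s hs hsu
      exact ⟨x, hx, hxu.trans huy⟩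
    · have huy' := huy
      unfold IsAncestor at huy'
      obtain ⟨x, hx, hxs⟩ := exists_dist_vertex_eq he.left_mem hy
        (s := s - dist (T.vertex r) (T.vertex u)) (by linarith) (by linarith)
      refine ⟨x, ?_, he.isAncestor_of_dist_le hx hy (by linarith)⟩
      have hux := he.isAncestor_left hx
      unfold IsAncestor at hux
      linarith

/-- The distance from the root to the parting point `m` of `z` and `w` is their Gromov product, so
the hypothesis puts `x` no farther out than `m`; both lie on the segment to `z`. -/
theorem isTreelikeAt_vertex (r : V) : IsTreelikeAt (T.vertex r) where
  exists_ancestor := T.exists_ancestor r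
  branch x z w hxz h := by
    obtain ⟨m, hmz, hmw, hm⟩ := T.exists_common_ancestor r z w
    have hxm : IsAncestor (T.vertex r) x m := by
      rcases T.isAncestor_or_isAncestor r z x m hxz hmz with hxm | hmx
      · exact hxm
      · rw [hmx.eq_of_dist_le ?_]
        · exact IsAncestor.refl _ _
        · unfold IsAncestor at hmz hmw
          rw [dist_comm z m] at hm
          linarith
    exact hxm.trans hmw

end MetricTree

theorem mainTheorem9 {V X : Type*} [MetricSpace X] (T : MetricTree V X) (hT : T.IsBounded)
    (f : X → X) (hf : Continuous f) (hfc : IsCompactMap f) :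
    ∃ x : X, f x = x := by
  obtain ⟨r⟩ := T.isTree.connected.nonempty
  -- Boundedness of the tree makes the whole image of `f` relatively compact.
  obtain ⟨K, hK, hfK⟩ := hfc Set.univ hT
  exact (T.isTreelikeAt_vertex r).exists_fixed_point hf hK
    fun x => hfK (Set.mem_image_of_mem f (Set.mem_univ x))
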